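/- Let $\mathbb F_q$ be a finite field with $q$ elements, $A=\mathbb F_q[\theta]$, $A_+\subset A$ the set of monic polynomials, $K=\mathbb F_q(\theta)$, and $K_\infty$ the completion of $K$ at the place $\infty$. Let $\mathfrak C$ be the $\mathbb F_q$-vector space with basis the set of words (including the empty word $1$) in the letters $x_n$, $n\ge 1$. Define two $\mathbb F_q$-bilinear products $\diamond$ and $ш$ on $\mathfrak C$ recursively by $1\diamond\mathfrak a=\mathfrak a\diamond 1=\mathfrak a$, $1\,ш\,\mathfrak a=\mathfrak a\,ш\,1=\mathfrak a$ and, for nonempty words $\mathfrak a=x_a\mathfrak a_-$ and $\mathfrak b=x_b\mathfrak b_-$, $$\mathfrak a\diamond\mathfrak b=x_{a+b}(\mathfrak a_-\,ш\,\mathfrak b_-)+\sum_{i+j=a+b,\ i,j\ge 1}\Delta^j_{a,b}\,x_i\bigl(x_j\,ш\,(\mathfrak a_-\,ш\,\mathfrak b_-)\bigr),$$ $$\mathfrak a\,ш\,\mathfrak b=x_a(\mathfrak a_-\,ш\,\mathfrak b)+x_b(\mathfrak a\,ш\,\mathfrak b_-)+\mathfrak a\diamond\mathfrak b,$$ where $\Delta^j_{a,b}=(-1)^{a-1}\binom{j-1}{a-1}+(-1)^{b-1}\binom{j-1}{b-1}$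 if $(q-1)\mid j$ and $0<j<a+b$, and $\Delta^j_{a,b}=0$ otherwise. For $d\in\mathbb Z$ let $S_{<d},\zeta_A:\mathfrak C\to K_\infty$ be the $\mathbb F_q$-linear maps that send a word $x_{s_1}\cdots x_{s_r}$ to $$\sum\frac1{a_1^{s_1}\cdots a_r^{s_r}},$$ where the sum runs over all $(a_1,\dots,a_r)\in A_+^r$ with $d>\deg a_1>\cdots>\deg a_r$ for $S_{<d}$, and with $\deg a_1>\cdots>\deg a_r$ for $\zeta_A$; the empty word is sent to $1$. Let $\mathcal Z\subset K_\infty$ be the $K$-subspace spanned by the multiple zeta values $\zeta_A(\mathfrak a)$, $\mathfrak a$ a word. Then: 1. $(\mathfrak C,\diamond)$ and $(\mathfrak C,ш)$ are commutative (associative) $\mathbb F_q$-algebras with unit the empty word. 2. $S_{<d}(\mathfrak a\,ш\,\mathfrak b)=S_{<d}(\mathfrak a)\,S_{<d}(\mathfrak b)$ for all $\mathfrak a,\mathfrak b\in\mathfrak C$ and all $d\in\mathbb Z$. 3. The series defining multiple zeta values converge, and $\zeta_A(\mathfrak a\,ш\,\mathfrak b)=\zeta_A(\mathfrak a)\,\zeta_A(\mathfrak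 b)$ for all $\mathfrak a,\mathfrak b\in\mathfrak C$. 4. $\mathcal Z$ is a $K$-subalgebra of $K_\infty$, and the $K$-linear map $Z:\mathfrak C\otimes_{\mathbb F_q}K\to\mathcal Z$ with $\mathfrak a\otimes 1\mapsto\zeta_A(\mathfrak a)$ for every word $\mathfrak a$ is a homomorphism of $K$-algebras, where $\mathfrak C$ carries the product $ш$. -/

import Mathlib

open Polynomial
open scoped TensorProduct

namespace ThakurMZV

noncomputable section

/-! ### The composition space -/

section Composition

variable (F : Type*) [Field F]

/-- The composition space: the free `F`-vector space on all words in the letters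
`x_n`, `n ≥ 1`.  The word `x_{s_1} ⋯ x_{s_r}` is the list `[s_1, …, s_r]`, and `[]` is the
empty word. -/
abbrev Comp : Type _ := List ℕ+ →₀ F

/-- The basis vector attached to a word. -/
def word (w : List ℕ+) : Comp F := Finsupp.single w 1

/-- `c ↦ x_a c`: left concatenation with the letter `x_a`, extended linearly. -/
def consL (a : ℕ+) : Comp F →ₗ[F] Comp F := Finsupp.lmapDomain F F (List.cons a)

/-- The coefficient `Δ^i_{a,b}`, with `q` the number of elements of `F`
(`PNat.natPred a` is `a - 1`). -/
def delta (a b i : ℕ+) : F :=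
  if (Nat.card F - 1) ∣ (i : ℕ) ∧ i < a + b then
    (-1) ^ a.natPred * ((i.natPred.choose a.natPred : ℕ) : F) +
      (-1) ^ b.natPred * ((i.natPred.choose b.natPred : ℕ) : F)
  else 0

/-- The shuffle product `x_j ⧢ w` of a letter and a word.  It is computed first because the
recursion for general words calls it on linear combinations of words; it agrees with the general
product below by `shuffle_letter`. The sum is over all `i + k = j + b` with `i, k ≥ 1`. -/
def letterShuffleWord : List ℕ+ → ℕ+ → Comp F
  | [], j => word F [j]
  | b :: v, j =>
      word F (j :: b :: v) + consL F b (letterShuffleWord v j) +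
        (word F ((j + b) :: v) +
          ∑ k ∈ Finset.Ico 1 (j + b),
            delta F j b k • consL F (j + b - k) (letterShuffleWord v k))

/-- `x_j ⧢ c` for `c` in the composition space. -/
def letterShuffle (j : ℕ+) : Comp F →ₗ[F] Comp F :=
  Finsupp.linearCombination F fun w => letterShuffleWord F w j

/-- The shuffle product of two words. -/
def shuffleWord : List ℕ+ → List ℕ+ → Comp F
  | [], v => word F v
  | a :: u, [] => word F (a :: u)
  | a :: u, b :: v =>
      consL F a (shuffleWord u (b :: v)) + consL F b (shuffleWord (a :: u) v) +
        (consL F (a + b) (shuffleWord u v) +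
          ∑ j ∈ Finset.Ico 1 (a + b),
            delta F a b j • consL F (a + b - j) (letterShuffle F j (shuffleWord u v)))
termination_by u v => u.length + v.length

/-- The diamond product of two words. -/
def diamondWord : List ℕ+ → List ℕ+ → Comp F
  | [], v => word F v
  | a :: u, [] => word F (a :: u)
  | a :: u, b :: v =>
      consL F (a + b) (shuffleWord F u v) +
        ∑ j ∈ Finset.Ico 1 (a + b),
          delta F a b j • consL F (a + b - j) (letterShuffle F j (shuffleWord F u v))

/-- The bilinear extension of a product of words. -/
def bilin (f : List ℕ+ → List ℕ+ → Comp F) : Comp F →ₗ[F] Comp F →ₗ[F] Comp F :=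
  Finsupp.linearCombination F fun u => Finsupp.linearCombination F (f u)

/-- The shuffle product `⧢` on the composition space. -/
def shuffle : Comp F →ₗ[F] Comp F →ₗ[F] Comp F := bilin F (shuffleWord F)

/-- The diamond product `⋄` on the composition space. -/
def diamond : Comp F →ₗ[F] Comp F →ₗ[F] Comp F := bilin F (diamondWord F)

theorem bilin_word (f : List ℕ+ → List ℕ+ → Comp F) (u v : List ℕ+) :
    bilin F f (word F u) (word F v) = f u v := by
  simp [bilin, word]

theorem consL_word (a : ℕ+) (w : List ℕ+) : consL F a (word F w) = word F (a :: w) := by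
  simp [consL, word, Finsupp.mapDomain_single]

/-! The following equations are the usual joint recursion defining `⋄` and `⧢`. -/

theorem shuffleWord_nil_right (u : List ℕ+) : shuffleWord F u [] = word F u := by
  cases u <;> simp [shuffleWord]

theorem diamondWord_nil_right (u : List ℕ+) : diamondWord F u [] = word F u := by
  cases u <;> simp [diamondWord]

theorem letterShuffleWord_eq (w : List ℕ+) (j : ℕ+) :
    shuffleWord F [j] w = letterShuffleWord F w j := by
  induction w generalizing j with
  | nil => simp [shuffleWord, letterShuffleWord]
  | cons b v ih =>
    rw [shuffleWord, letterShuffleWord, ih]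
    simp only [shuffleWord, consL_word]
    simp [letterShuffle, word]

theorem shuffle_letter (j : ℕ+) : shuffle F (word F [j]) = letterShuffle F j := by
  have hw : shuffleWord F [j] = fun w => letterShuffleWord F w j :=
    funext fun w => letterShuffleWord_eq F w j
  simp [shuffle, bilin, word, letterShuffle, hw]

theorem shuffle_nil_left (v : List ℕ+) : shuffle F (word F []) (word F v) = word F v := by
  simp [shuffle, bilin_word, shuffleWord]

theorem shuffle_nil_right (u : List ℕ+) : shuffle F (word F u) (word F []) = word F u := by
  simp [shuffle, bilin_word, shuffleWord_nil_right]

theorem diamond_nil_left (v : List ℕ+) : diamond F (word F []) (word F v) = word F v := by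
  simp [diamond, bilin_word, diamondWord]

theorem diamond_nil_right (u : List ℕ+) : diamond F (word F u) (word F []) = word F u := by
  simp [diamond, bilin_word, diamondWord_nil_right]

theorem diamond_cons_cons (a b : ℕ+) (u v : List ℕ+) :
    diamond F (word F (a :: u)) (word F (b :: v)) =
      consL F (a + b) (shuffle F (word F u) (word F v)) +
        ∑ j ∈ Finset.Ico 1 (a + b),
          delta F a b j •
            consL F (a + b - j)
              (shuffle F (word F [j]) (shuffle F (word F u) (word F v))) := by
  simp only [shuffle_letter]
  simp only [diamond, shuffle, bilin_word]
  rw [diamondWord]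

theorem shuffle_cons_cons (a b : ℕ+) (u v : List ℕ+) :
    shuffle F (word F (a :: u)) (word F (b :: v)) =
      consL F a (shuffle F (word F u) (word F (b :: v))) +
        consL F b (shuffle F (word F (a :: u)) (word F v)) +
        diamond F (word F (a :: u)) (word F (b :: v)) := by
  rw [diamond_cons_cons]
  simp only [shuffle_letter]
  simp only [shuffle, bilin_word]
  rw [shuffleWord]

end Composition

/-! ### Algebras given by a bilinear product -/

section Products

variable {F V : Type*} [Field F] [AddCommGroup V] [Module F V]

/-- The bilinear product `m` on the `F`-vector space `V` is commutative and associative, with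
unit `e`. -/
structure IsCommAlgProduct (m : V →ₗ[F] V →ₗ[F] V) (e : V) : Prop where
  comm : ∀ x y, m x y = m y x
  assoc : ∀ x y z, m (m x y) z = m x (m y z)
  one_mul : ∀ x, m e x = x

/-- The vector space `V` regarded as a commutative `F`-algebra with product `m` and unit `e`. -/
def WithProduct {m : V →ₗ[F] V →ₗ[F] V} {e : V} (_h : IsCommAlgProduct m e) : Type _ := V

variable {m : V →ₗ[F] V →ₗ[F] V} {e : V} (h : IsCommAlgProduct m e)

instance : AddCommGroup (WithProduct h) := inferInstanceAs (AddCommGroup V)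

instance : Module F (WithProduct h) := inferInstanceAs (Module F V)

/-- The element `x` of `V` regarded as an element of the algebra. -/
def WithProduct.of (x : V) : WithProduct h := x

instance : CommRing (WithProduct h) :=
  { (inferInstance : AddCommGroup (WithProduct h)) with
    mul := fun x y => (m (x : V) (y : V) : V)
    one := (e : V)
    left_distrib := fun x y z => map_add (m (x : V)) (y : V) (z : V)
    right_distrib := fun x y z => LinearMap.map_add₂ m (x : V) (y : V) (z : V)
    zero_mul := fun x => LinearMap.map_zero₂ m (x : V)
    mul_zero := fun x => map_zero (m (x : V))
    mul_assoc := h.assoc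
    one_mul := h.one_mul
    mul_one := fun x => (h.comm _ _).trans (h.one_mul x)
    mul_comm := h.comm }

instance : Algebra F (WithProduct h) :=
  Algebra.ofModule (fun c x y => LinearMap.map_smul₂ m c (x : V) (y : V))
    (fun c x y => map_smul (m (x : V)) c (y : V))

end Products

/-! ### Multiple zeta values -/

section Zeta

variable (F : Type*) [Field F]

open Classical in
/-- The completion of `F(θ)` at the place `∞`. -/
abbrev KInf : Type _ := RatFunc.CompletionAtInfty F

instance : Algebra F (KInf F) :=
  ((algebraMap (RatFunc F) (KInf F)).comp (algebraMap F (RatFunc F))).toAlgebra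

/-- Tuples `(a_1, …, a_r)` of monic polynomials with `deg a_1 > ⋯ > deg a_r`. -/
def Chain (r : ℕ) : Type _ :=
  {a : Fin r → F[X] //
    (∀ i, (a i).Monic) ∧ ∀ i j, i < j → (a j).natDegree < (a i).natDegree}

/-- The term `1 / (a_1^{s_1} ⋯ a_r^{s_r})`, as an element of the completion. -/
def term (s : List ℕ+) (a : Chain F s.length) : KInf F :=
  algebraMap (RatFunc F) (KInf F)
    (∏ i, 1 / (algebraMap F[X] (RatFunc F) (a.1 i)) ^ (s.get i : ℕ))

/-- The multiple zeta value `ζ_A(s_1, …, s_r)`. -/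
def zetaWord (s : List ℕ+) : KInf F := ∑' a, term F s a

/-- The linear map `ζ_A` from the composition space to the completion. -/
def zeta : Comp F →ₗ[F] KInf F := Finsupp.linearCombination F (zetaWord F)

/-- There are finitely many chains with all degrees `< d`. -/
theorem finite_chains [Finite F] (r : ℕ) (d : ℤ) :
    {a : Chain F r | ∀ i, ((a.1 i).natDegree : ℤ) < d}.Finite := by
  have h1 : {p : F[X] | (p.natDegree : ℤ) < d}.Finite := by
    have : Finite (degreeLT F d.toNat) :=
      Finite.of_equiv _ (degreeLTEquiv F d.toNat).toEquiv.symm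
    refine Set.Finite.subset (Set.toFinite (degreeLT F d.toNat : Set F[X])) fun p hp => ?_
    rw [Set.mem_ofPred_eq] at hp
    rw [SetLike.mem_coe, mem_degreeLT]
    refine lt_of_le_of_lt degree_le_natDegree ?_
    exact_mod_cast (by omega : p.natDegree < d.toNat)
  have h2 : {a : Fin r → F[X] | ∀ i, a i ∈ {p : F[X] | (p.natDegree : ℤ) < d}}.Finite :=
    Set.Finite.pi' fun _ => h1
  exact Set.Finite.preimage Subtype.val_injective.injOn h2

/-- The power sum `S_{<d}(s_1, …, s_r)`, over the tuples with `d > deg a_1 > ⋯ > deg a_r`. -/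
def powerSumWord [Finite F] (d : ℤ) (s : List ℕ+) : KInf F :=
  ∑ a ∈ (finite_chains F s.length d).toFinset, term F s a

/-- The linear map `S_{<d}` from the composition space to the completion. -/
def powerSum [Finite F] (d : ℤ) : Comp F →ₗ[F] KInf F :=
  Finsupp.linearCombination F (powerSumWord F d)

/-- The `F(θ)`-vector space spanned by the multiple zeta values. -/
def mzvSpace : Submodule (RatFunc F) (KInf F) :=
  Submodule.span (RatFunc F) (Set.range (zetaWord F))

end Zeta

end

end ThakurMZV

open ThakurMZV

/-! Both products are realised inside commutative rings of functions. For a sequence `t` in a field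
extension `L` of `F`, replace the monic polynomials of degree `d` by the elements `t d + ∑_{i<d} c_i
t_i`. Summing inverse powers over these gives level sums, and nesting them over decreasing levels
gives a linear map `nestedL` from words to sequences in `L`.

If `t` is linearly independent over `F`, then `nestedL` turns `⧢` into the pointwise product. The
core is `levelSum_mul`. In a product of two sums at one level, the diagonal terms give the exponent
`a + b`. Partial fractions rewrite each off-diagonal term through the difference of the two
elements, which runs over nonzero vectors of the span of the lower `t_i`. Grouping these vectors by
leading coefficient brings in `∑ r⁻¹ ^ j` over `F`, hence the condition `(q - 1) ∣ j` in `delta`.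
Splitting a product of nested sums by comparing top levels then reproduces the recursion for `⧢`.

For `t_i = θ^i` this is multiplicativity of `S_{<d}`, and letting `d` grow gives that of `ζ_A`. For
algebraically independent `t`, `nestedL` is moreover injective (`nestedL_injective`), so `⧢`
inherits commutativity and associativity from a ring of sequences. For `⋄` the same argument runs
with `topL`, which keeps only the terms at the top level. Finally, the span of the zeta values is
the image of an algebra homomorphism, hence a subalgebra. -/

namespace ThakurMZV

noncomputable section

/-! ### Partial fractions -/

/-- Partial fraction decomposition of `1 / (x ^ (α + 1) * y ^ (β + 1))` with respect to `x`
and `y`, written in terms of `X = 1 / x`, `Y = 1 / y` and `Z = 1 / (x - y)`. -/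
theorem partialFraction {R : Type*} [CommRing R] {X Y Z : R} (h : X * Y = Z * (Y - X)) (α β : ℕ) :
    X ^ (α + 1) * Y ^ (β + 1) =
      ∑ j ∈ Finset.range (α + β + 1),
        ((-1) ^ (β + 1) * (j.choose β : R) * X ^ (α + β + 1 - j) * Z ^ (j + 1) +
          (-1) ^ (α + 1) * (j.choose α : R) * Y ^ (α + β + 1 - j) * (-Z) ^ (j + 1)) := by
  -- The recursion below lowers one exponent at a time, so it needs the cases where an exponent is
  -- 1. The relation is invariant under `(X, Y, Z) ↦ (Y, X, -Z)`, so one computation serves both.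
  have base : ∀ {X Y Z : R}, X * Y = Z * (Y - X) → ∀ α : ℕ, X ^ (α + 1) * Y =
      Y * Z ^ (α + 1) - ∑ j ∈ Finset.range (α + 1), X ^ (α + 1 - j) * Z ^ (j + 1) := by
    intro X Y Z h α
    induction α with
    | zero => simp; linear_combination h
    | succ α ih =>
      have e : X ^ (α + 1 + 1) * Y = Z * (X ^ (α + 1) * Y) - Z * X ^ (α + 2) := by
        linear_combination X ^ (α + 1) * h
      rw [e, ih, Finset.sum_range_succ' _ (α + 1), mul_sub, Finset.mul_sum]
      have : ∀ j ∈ Finset.range (α + 1), Z * (X ^ (α + 1 - j) * Z ^ (j + 1)) =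
          X ^ (α + 1 + 1 - (j + 1)) * Z ^ (j + 1 + 1) := by
        intro j _
        rw [Nat.add_sub_add_right]; ring
      rw [Finset.sum_congr rfl this]
      simp only [Nat.sub_zero]
      ring
  induction n : α + β using Nat.strong_induction_on generalizing α β with
  | _ n ih =>
  subst n
  rcases α with _ | α
  · have h' : Y * X = (-Z) * (X - Y) := by linear_combination h
    rw [pow_one, mul_comm, base h' β, Finset.sum_add_distrib, zero_add,
      Finset.sum_range_succ (fun j => (-1) ^ (β + 1) * (j.choose β : R) * _ * _)]
    rw [Finset.sum_eq_zero (s := Finset.range β)]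
    · simp only [Nat.choose_self, Nat.choose_zero_right, Finset.sum_neg_distrib, pow_one, neg_mul,
        one_mul, Nat.cast_one, zero_add, mul_one, Nat.add_sub_cancel_left, neg_pow Z (β + 1)]
      ring
    · intro j hj
      simp [Nat.choose_eq_zero_of_lt (Finset.mem_range.1 hj)]
  rcases β with _ | β
  · rw [zero_add, pow_one, base h (α + 1), Finset.sum_add_distrib, add_zero,
      Finset.sum_range_succ (fun j => (-1) ^ (α + 1 + 1) * (j.choose (α + 1) : R) * _ * _)]
    rw [Finset.sum_eq_zero (s := Finset.range (α + 1))]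
    · simp only [Nat.choose_self, Nat.choose_zero_right, Finset.sum_neg_distrib, pow_one, neg_mul,
        one_mul, Nat.cast_one, zero_add, mul_one, Nat.add_sub_cancel_left, neg_pow Z (α + 1 + 1)]
      have := pow_mul_pow_eq_one (α + 1 + 1) (show (-1 : R) * -1 = 1 by ring)
      linear_combination (-Y * Z ^ (α + 1 + 1)) * this
    · intro j hj
      simp [Nat.choose_eq_zero_of_lt (Finset.mem_range.1 hj)]
  -- Multiplying the relation by a monomial gives two terms of smaller total exponent; their
  -- binomial coefficients combine by Pascal's rule after shifting `j`.
  · have e : X ^ (α + 1 + 1) * Y ^ (β + 1 + 1) =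
        Z * (X ^ (α + 1) * Y ^ (β + 1 + 1)) - Z * (X ^ (α + 1 + 1) * Y ^ (β + 1)) := by
      linear_combination X ^ (α + 1) * Y ^ (β + 1) * h
    rw [e, ih (α + (β + 1)) (by omega) α (β + 1) rfl, ih (α + 1 + β) (by omega) (α + 1) β rfl,
      show α + 1 + (β + 1) = α + β + 1 + 1 by ring, show α + (β + 1) = α + β + 1 by ring,
      show α + 1 + β = α + β + 1 by ring, Finset.sum_range_succ' _ (α + β + 1 + 1),
      Finset.mul_sum, Finset.mul_sum, ← Finset.sum_sub_distrib]
    simp only [Nat.choose_zero_succ, Nat.cast_zero, mul_zero, zero_mul, add_zero]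
    refine Finset.sum_congr rfl fun j _ => ?_
    rw [Nat.choose_succ_succ, Nat.choose_succ_succ, Nat.add_sub_add_right]
    push_cast
    ring

theorem sum_Ico_pnat {M : Type*} [AddCommMonoid M] (n : ℕ) (m : ℕ+) (hm : (m : ℕ) = n + 1)
    (f : ℕ+ → M) :
    ∑ j ∈ Finset.Ico 1 m, f j = ∑ j ∈ Finset.range n, f j.succPNat := by
  refine Finset.sum_bij' (fun j _ => j.natPred) (fun j _ => j.succPNat) ?_ ?_ ?_ ?_ ?_
  · intro j hj
    have := (Finset.mem_Ico.1 hj).2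
    rw [← PNat.coe_lt_coe, hm] at this
    have h2 := PNat.natPred_add_one j
    simp; omega
  · intro j hj
    have := Finset.mem_range.1 hj
    rw [Finset.mem_Ico, ← PNat.coe_lt_coe, hm]
    exact ⟨one_le, by simpa using this⟩
  · intro j _; simp
  · intro j _; simp
  · intro j _; simp

/-- The signs are arranged to match `delta`: the remaining minus signs cancel the `-1` of
`sum_inv_pow`. -/
theorem partialFraction_pnat {R : Type*} [CommRing R] {X Y Z : R} (h : X * Y = Z * (Y - X))
    (a b : ℕ+) :
    X ^ (a : ℕ) * Y ^ (b : ℕ) =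
      ∑ j ∈ Finset.Ico 1 (a + b),
        (-((-1) ^ b.natPred * (j.natPred.choose b.natPred : R)) *
            (X ^ ((a + b - j : ℕ+) : ℕ) * Z ^ (j : ℕ)) -
          (-1) ^ a.natPred * (j.natPred.choose a.natPred : R) *
            (Y ^ ((a + b - j : ℕ+) : ℕ) * (-Z) ^ (j : ℕ))) := by
  have ha := PNat.natPred_add_one a
  have hb := PNat.natPred_add_one b
  rw [sum_Ico_pnat (a.natPred + b.natPred + 1) _ (by rw [PNat.add_coe]; omega)]
  rw [← ha, ← hb, partialFraction h]
  refine Finset.sum_congr rfl fun j hj => ?_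
  have hj := Finset.mem_range.1 hj
  have : ((a + b - j.succPNat : ℕ+) : ℕ) = a.natPred + b.natPred + 1 - j := by
    rw [PNat.sub_coe, if_pos, PNat.add_coe, Nat.succPNat_coe]
    · omega
    · rw [← PNat.coe_lt_coe, PNat.add_coe, Nat.succPNat_coe]; omega
  rw [this]
  simp only [Nat.natPred_succPNat, Nat.succPNat_coe, Nat.succ_eq_add_one, pow_succ (-1 : R)]
  ring

/-! ### Power sums attached to a sequence in a field extension -/

section PowerSums

variable {F : Type*} [Field F] {L : Type*} [Field L] [Algebra F L]

/-- The linear combination `∑_{i < d} c_i t_i`. -/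
def linComb (t : ℕ → L) (d : ℕ) (c : Fin d → F) : L := ∑ i, c i • t i

theorem linComb_sub (t : ℕ → L) (d : ℕ) (c c' : Fin d → F) :
    linComb t d (c - c') = linComb t d c - linComb t d c' := by
  simp [linComb, sub_smul]

theorem linComb_smul (t : ℕ → L) (d : ℕ) (r : F) (c : Fin d → F) :
    linComb t d (r • c) = r • linComb t d c := by
  simp [linComb, Finset.smul_sum, mul_smul]

theorem linComb_snoc (t : ℕ → L) (d : ℕ) (r : F) (c : Fin d → F) :
    linComb t (d + 1) (Fin.snoc c r : Fin (d + 1) → F) = r • t d + linComb t d c := by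
  simp [linComb, Fin.sum_univ_castSucc, add_comm]

theorem linComb_injective {t : ℕ → L} (ht : LinearIndependent F t) (d : ℕ) :
    Function.Injective (linComb (F := F) t d) := by
  have h : LinearIndependent F fun i : Fin d => t i :=
    ht.comp (fun i : Fin d => (i : ℕ)) Fin.val_injective
  exact linearIndependent_iff_injective_fintypeLinearCombination.1 h

/-- Since `0⁻¹ = 0` and `j ≠ 0`, the term `r = 0` vanishes and a power sum over the cyclic group
`Fˣ` remains. -/
theorem sum_inv_pow (j : ℕ) (hj : j ≠ 0) [Fintype F] :
    ∑ r : F, r⁻¹ ^ j = if (Nat.card F - 1) ∣ j then -1 else 0 := by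
  classical
  rw [Nat.card_eq_fintype_card, ← FiniteField.sum_pow_units, ← Equiv.sum_comp (Equiv.inv Fˣ)]
  symm
  refine Finset.sum_bij_ne_zero (fun u _ _ => (u : F)) (by simp)
    (fun _ _ _ _ _ _ h => Units.ext h) ?_ (by simp)
  intro r _ hr
  have : r ≠ 0 := by
    rintro rfl; simp [hj] at hr
  exact ⟨Units.mk0 r this, by simp, by simp [this], rfl⟩

variable [Finite F]

instance (d : ℕ) : Fintype (Fin d → F) := Fintype.ofFinite _

variable (F) in
/-- The power sum `∑ 1 / x ^ a` over all `x = t_d + ∑_{i < d} c_i t_i`. -/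
def levelSum (t : ℕ → L) (d a : ℕ) : L := ∑ c : Fin d → F, (t d + linComb t d c)⁻¹ ^ a

variable (F) in
/-- The nested power sum attached to a word. -/
def nested (t : ℕ → L) : List ℕ+ → ℕ → L
  | [], _ => 1
  | a :: u, d => ∑ e ∈ Finset.range d, levelSum F t e a * nested t u e

variable (F) in
/-- The linear extension of `nested` to the composition space. -/
def nestedL (t : ℕ → L) : Comp F →ₗ[F] ℕ → L := Finsupp.linearCombination F (nested F t)

@[simp] theorem nestedL_word (t : ℕ → L) (u : List ℕ+) : nestedL F t (word F u) = nested F t u := by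
  simp [nestedL, word]

theorem nestedL_consL (t : ℕ → L) (a : ℕ+) (x : Comp F) (d : ℕ) :
    nestedL F t (consL F a x) d = ∑ e ∈ Finset.range d, levelSum F t e a * nestedL F t x e := by
  induction x using Finsupp.induction_linear with
  | zero => simp
  | add x y hx hy => simp [hx, hy, mul_add, Finset.sum_add_distrib]
  | single w r =>
    have : Finsupp.single w r = r • word F w := by simp [word]
    rw [this, map_smul, consL_word, map_smul, map_smul]
    simp [nested, Finset.smul_sum]

/-- The power sum over the nonzero elements of the span of `t_i`, `i < d`. -/
theorem sum_linComb_inv_pow (t : ℕ → L) (j : ℕ+) (d : ℕ) :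
    ∑ c : Fin d → F, (linComb t d c)⁻¹ ^ (j : ℕ) =
      (if (Nat.card F - 1) ∣ (j : ℕ) then (-1 : F) else 0) • nested F t [j] d := by
  classical
  have : Fintype F := Fintype.ofFinite F
  induction d with
  | zero => simp [linComb, nested]
  | succ d ih =>
    rw [← Equiv.sum_comp (Fin.snocEquiv fun _ => F), Fintype.sum_prod_type]
    -- Group the vectors by their coefficient `r` at `t d`. If `r ≠ 0`, rescaling by `r` leads to
    -- the level sum; if `r = 0`, the vector lies in the preceding span. The zero vector contributes
    -- `0`.
    have key : ∀ r : F, ∑ c : Fin d → F,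
        (linComb t (d + 1) ((Fin.snocEquiv fun _ => F) (r, c)))⁻¹ ^ (j : ℕ) =
        r⁻¹ ^ (j : ℕ) • levelSum F t d j +
          if r = 0 then ∑ c : Fin d → F, (linComb t d c)⁻¹ ^ (j : ℕ) else 0 := by
      intro r
      have e : ∀ c : Fin d → F, linComb t (d + 1) ((Fin.snocEquiv fun _ => F) (r, c)) =
        r • t d + linComb t d c := fun c => linComb_snoc t d r c
      simp only [e]
      split_ifs with hr
      · simp [hr]
      · rw [add_zero, levelSum, Finset.smul_sum,
          ← Equiv.sum_comp (MulAction.toPerm (Units.mk0 r hr) : Equiv.Perm (Fin d → F))]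
        refine Finset.sum_congr rfl fun c _ => ?_
        have : linComb t d ((MulAction.toPerm (Units.mk0 r hr) : Equiv.Perm (Fin d → F)) c) =
          r • linComb t d c := linComb_smul t d r c
        rw [this, ← smul_add, Algebra.smul_def, Algebra.smul_def, mul_inv, mul_pow, map_pow,
          map_inv₀]
    simp only [key]
    rw [Finset.sum_add_distrib, ← Finset.sum_smul, sum_inv_pow _ j.ne_zero]
    simp only [Finset.sum_ite_eq', Finset.mem_univ, if_true]
    rw [ih, ← smul_add]
    simp only [nested, Finset.sum_range_succ, mul_one]
    rw [add_comm]

/-- Expand into a double sum over pairs and treat the diagonal separately. With one element of the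
pair fixed, its difference from the other runs over the span of the lower `t_i`, so
`sum_linComb_inv_pow` evaluates the inner sums. -/
theorem levelSum_mul {t : ℕ → L} (ht : LinearIndependent F t) (a b : ℕ+) (d : ℕ) :
    levelSum F t d a * levelSum F t d b =
      levelSum F t d (a + b : ℕ+) +
        ∑ j ∈ Finset.Ico 1 (a + b),
          delta F a b j • (levelSum F t d (a + b - j : ℕ+) * nested F t [j] d) := by
  classical
  set x : (Fin d → F) → L := fun c => t d + linComb t d c with hx
  have hx0 : ∀ c, x c ≠ 0 := by
    intro c h
    have h1 : linComb t (d + 1) (Fin.snoc c 1 : Fin (d + 1) → F) =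
        linComb t (d + 1) (0 : Fin (d + 1) → F) := by
      rw [linComb_snoc, one_smul]
      simpa [linComb, hx] using h
    have h2 := congrFun (linComb_injective ht _ h1) (Fin.last d)
    simp at h2
  have hxs : ∀ c c', x c - x c' = linComb t d (c - c') := fun c c' => by
    rw [linComb_sub]; simp [hx]
  have hxi : ∀ c c', x c = x c' → c = c' := fun c c' h =>
    linComb_injective ht d (add_left_cancel h)
  -- On the diagonal the partial fraction terms vanish because `0⁻¹ = 0`, so the sum over `j` may
  -- run over all pairs.
  have term : ∀ c c', (x c)⁻¹ ^ (a : ℕ) * (x c')⁻¹ ^ (b : ℕ) =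
      (if c = c' then (x c)⁻¹ ^ ((a + b : ℕ+) : ℕ) else 0) +
      ∑ j ∈ Finset.Ico 1 (a + b),
        (-((-1) ^ b.natPred * (j.natPred.choose b.natPred : L)) *
            ((x c)⁻¹ ^ ((a + b - j : ℕ+) : ℕ) * (linComb t d (c - c'))⁻¹ ^ (j : ℕ)) -
          (-1) ^ a.natPred * (j.natPred.choose a.natPred : L) *
            ((x c')⁻¹ ^ ((a + b - j : ℕ+) : ℕ) * (linComb t d (c' - c))⁻¹ ^ (j : ℕ))) := by
    intro c c'
    by_cases h : c = c'
    · subst h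
      rw [if_pos rfl, Finset.sum_eq_zero, PNat.add_coe, pow_add, add_zero]
      intro j _
      have : linComb t d (0 : Fin d → F) = 0 := by simp [linComb]
      simp only [this, inv_zero, zero_pow j.ne_zero, mul_zero, sub_self]
    · have hne : x c - x c' ≠ 0 := sub_ne_zero.2 fun e => h (hxi _ _ e)
      have hc := hx0 c
      have hc' := hx0 c'
      rw [if_neg h, zero_add, partialFraction_pnat (Z := (x c - x c')⁻¹)]
      · refine Finset.sum_congr rfl fun j _ => ?_
        rw [← hxs, ← hxs, ← inv_neg, neg_sub]
      · field_simp
  have expand : levelSum F t d a * levelSum F t d b =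
      ∑ c, ∑ c', (x c)⁻¹ ^ (a : ℕ) * (x c')⁻¹ ^ (b : ℕ) := by
    rw [levelSum, levelSum, Finset.sum_mul_sum]
  rw [expand]
  simp only [term, Finset.sum_add_distrib, Finset.sum_ite_eq, Finset.mem_univ, if_true]
  congr 1
  rw [Finset.sum_congr rfl fun c _ => Finset.sum_comm, Finset.sum_comm]
  refine Finset.sum_congr rfl fun j hj => ?_
  have hj2 := (Finset.mem_Ico.1 hj).2
  have inner : ∀ i : ℕ, ∑ c, ∑ c', (x c)⁻¹ ^ i * (linComb t d (c - c'))⁻¹ ^ (j : ℕ) =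
      levelSum F t d i *
        ((if (Nat.card F - 1) ∣ (j : ℕ) then (-1 : F) else 0) • nested F t [j] d) := by
    intro i
    rw [← sum_linComb_inv_pow, levelSum, Finset.sum_mul]
    refine Finset.sum_congr rfl fun c _ => ?_
    rw [← Finset.mul_sum]
    congr 1
    exact Equiv.sum_comp (Equiv.subLeft c) fun c' => (linComb t d c')⁻¹ ^ (j : ℕ)
  have inner' : ∀ i : ℕ, ∑ c, ∑ c', (x c')⁻¹ ^ i * (linComb t d (c' - c))⁻¹ ^ (j : ℕ) =
      levelSum F t d i *
        ((if (Nat.card F - 1) ∣ (j : ℕ) then (-1 : F) else 0) • nested F t [j] d) := fun i => by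
    rw [Finset.sum_comm, inner]
  simp only [Finset.sum_sub_distrib]
  simp_rw [← Finset.mul_sum] at inner inner' ⊢
  rw [inner, inner', delta]
  by_cases hd : (Nat.card F - 1) ∣ (j : ℕ)
  · rw [if_pos hd, if_pos ⟨hd, hj2⟩]
    simp only [Algebra.smul_def, map_neg, map_one, map_add, map_mul, map_pow, map_natCast]
    ring
  · rw [if_neg hd, if_neg fun h => hd h.1]
    simp

end PowerSums

section PowerSums

variable {F : Type*} [Field F] {L : Type*} [Field L] [Algebra F L]

/-! ### Multiplicativity of the nested power sums -/

/-- Pairs of indices are split by which one is larger; this is the source of the three summands of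
`⧢`. -/
theorem sum_range_mul_sum_range {R : Type*} [CommRing R] (f g : ℕ → R) (d : ℕ) :
    (∑ e ∈ Finset.range d, f e) * ∑ e ∈ Finset.range d, g e =
      ∑ e ∈ Finset.range d, (f e * ∑ i ∈ Finset.range e, g i) +
        ∑ e ∈ Finset.range d, (g e * ∑ i ∈ Finset.range e, f i) +
          ∑ e ∈ Finset.range d, f e * g e := by
  induction d with
  | zero => simp
  | succ d ih =>
    simp only [Finset.sum_range_succ]
    linear_combination ih

/-- If a linear map to a commutative algebra is multiplicative on words, then it is so on the
bilinear extension. -/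
theorem map_bilin {R : Type*} [CommRing R] [Algebra F R] (φ : Comp F →ₗ[F] R)
    {f : List ℕ+ → List ℕ+ → Comp F}
    (h : ∀ u v, φ (f u v) = φ (word F u) * φ (word F v)) (x y : Comp F) :
    φ (bilin F f x y) = φ x * φ y := by
  have : (bilin F f).compr₂ φ = (LinearMap.mul F R).compl₁₂ φ φ := by
    refine Finsupp.lhom_ext' fun u => LinearMap.ext_ring (Finsupp.lhom_ext' fun v =>
      LinearMap.ext_ring ?_)
    simpa [bilin, word] using h u v
  simpa using LinearMap.congr_fun₂ this x y

/-- A bilinear product which embeds into a commutative ring is commutative and associative. -/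
theorem isCommAlgProduct_of_injective {V R : Type*} [AddCommGroup V] [Module F V] [CommRing R]
    {m : V →ₗ[F] V →ₗ[F] V} {e : V} (φ : V → R) (hφ : Function.Injective φ)
    (hm : ∀ x y, φ (m x y) = φ x * φ y) (he : φ e = 1) : IsCommAlgProduct m e where
  comm x y := hφ (by rw [hm, hm, mul_comm])
  assoc x y z := hφ (by rw [hm, hm, hm, hm, mul_assoc])
  one_mul x := hφ (by rw [hm, he, one_mul])

variable [Finite F]

/-- The recursive formulas for `⧢` are compatible with nested power sums. -/
theorem nestedL_recursion {t : ℕ → L} (ht : LinearIndependent F t) (a b : ℕ+) (u v : List ℕ+)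
    {A B C : Comp F} {D : ℕ+ → Comp F}
    (hA : nestedL F t A = nested F t u * nested F t (b :: v))
    (hB : nestedL F t B = nested F t (a :: u) * nested F t v)
    (hC : nestedL F t C = nested F t u * nested F t v)
    (hD : ∀ j, nestedL F t (D j) = nested F t [j] * (nested F t u * nested F t v)) :
    nestedL F t (consL F a A + consL F b B + (consL F (a + b) C +
      ∑ j ∈ Finset.Ico 1 (a + b), delta F a b j • consL F (a + b - j) (D j))) =
    nested F t (a :: u) * nested F t (b :: v) := by
  funext d
  simp only [map_add, map_sum, map_smul, Pi.add_apply, Finset.sum_apply, Pi.smul_apply,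
    nestedL_consL, hA, hB, hC, hD, Pi.mul_apply]
  have h1 : ∀ (c : ℕ+) (w : List ℕ+) (e : ℕ),
      nested F t (c :: w) e = ∑ i ∈ Finset.range e, levelSum F t i c * nested F t w i :=
    fun _ _ _ => rfl
  rw [h1 a u d, h1 b v d, sum_range_mul_sum_range]
  simp only [← h1]
  congr 1
  · congr 1 <;> exact Finset.sum_congr rfl fun e _ => by ring
  · simp only [Finset.smul_sum]
    rw [Finset.sum_comm, ← Finset.sum_add_distrib]
    refine Finset.sum_congr rfl fun e _ => ?_
    have : levelSum F t e a * nested F t u e * (levelSum F t e b * nested F t v e) =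
      levelSum F t e a * levelSum F t e b * (nested F t u e * nested F t v e) := by ring
    -- Equal top levels produce the diamond part of the recursion.
    rw [this, levelSum_mul ht, add_mul, Finset.sum_mul]
    congr 1
    refine Finset.sum_congr rfl fun j _ => ?_
    simp only [Algebra.smul_def]
    ring

theorem nestedL_single (t : ℕ → L) (w : List ℕ+) (r : F) :
    nestedL F t (Finsupp.single w r) = r • nested F t w := by
  simp [nestedL]

theorem nestedL_letterShuffle_of_word {t : ℕ → L} {j : ℕ+}
    (h : ∀ w, nestedL F t (letterShuffleWord F w j) = nested F t [j] * nested F t w) (x : Comp F) :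
    nestedL F t (letterShuffle F j x) = nested F t [j] * nestedL F t x := by
  induction x using Finsupp.induction_linear with
  | zero => simp
  | add x y hx hy => simp [hx, hy, mul_add]
  | single w r => simp [letterShuffle, h, nestedL_single]

/-- The case `u = []` of the recursion, settled first because the general product calls it. The
letter `j` varies in the induction since the recursion passes to other letters `k`. -/
theorem nestedL_letterShuffleWord {t : ℕ → L} (ht : LinearIndependent F t) (w : List ℕ+) (j : ℕ+) :
    nestedL F t (letterShuffleWord F w j) = nested F t [j] * nested F t w := by
  have h1 : nested F t [] = 1 := rfl
  induction w generalizing j with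
  | nil => simp [letterShuffleWord, h1]
  | cons b v ih =>
    rw [letterShuffleWord, ← consL_word F j, ← consL_word F (j + b)]
    exact nestedL_recursion ht j b [] v (by simp [h1]) (ih j) (by simp [h1])
      (fun k => by rw [ih, h1, one_mul])

theorem nestedL_letterShuffle {t : ℕ → L} (ht : LinearIndependent F t) (j : ℕ+) (x : Comp F) :
    nestedL F t (letterShuffle F j x) = nested F t [j] * nestedL F t x :=
  nestedL_letterShuffle_of_word (fun w => nestedL_letterShuffleWord ht w j) x

theorem nestedL_shuffleWord {t : ℕ → L} (ht : LinearIndependent F t) (u v : List ℕ+) :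
    nestedL F t (shuffleWord F u v) = nested F t u * nested F t v := by
  have h1 : nested F t [] = 1 := rfl
  induction n : u.length + v.length using Nat.strong_induction_on generalizing u v with
  | _ n ih =>
  subst n
  match u, v with
  | [], v => simp [shuffleWord, h1]
  | a :: u, [] => simp [shuffleWord, h1]
  | a :: u, b :: v =>
    rw [shuffleWord]
    have hC := ih _ (by simp; omega) u v rfl
    refine nestedL_recursion ht a b u v (ih _ (by simp) _ _ rfl) (ih _ (by simp) _ _ rfl) hC
      fun j => ?_
    rw [nestedL_letterShuffle ht, hC]

theorem nestedL_shuffle {t : ℕ → L} (ht : LinearIndependent F t) (x y : Comp F) :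
    nestedL F t (shuffle F x y) = nestedL F t x * nestedL F t y :=
  map_bilin _ (fun u v => by simp [nestedL_shuffleWord ht]) x y

/-! ### The diamond product on the top level -/

variable (F) in
/-- The contribution of the top level to the nested power sum of a word. -/
def topSum (t : ℕ → L) : List ℕ+ → ℕ → L
  | [], _ => 1
  | a :: u, d => levelSum F t d a * nested F t u d

variable (F) in
/-- The coefficient of the empty word together with the linear extension of `topSum`. -/
def topL (t : ℕ → L) : Comp F →ₗ[F] F × (ℕ → L) :=
  (Finsupp.lapply []).prod (Finsupp.linearCombination F (topSum F t))

theorem topL_word_nil (t : ℕ → L) : topL F t (word F []) = 1 := by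
  ext <;> simp [topL, word, topSum]

theorem topL_word_cons (t : ℕ → L) (a : ℕ+) (u : List ℕ+) :
    topL F t (word F (a :: u)) = (0, fun d => levelSum F t d a * nested F t u d) := by
  ext <;> simp [topL, word, topSum]

theorem topL_consL (t : ℕ → L) (a : ℕ+) (x : Comp F) :
    topL F t (consL F a x) = (0, fun d => levelSum F t d a * nestedL F t x d) := by
  induction x using Finsupp.induction_linear with
  | zero => ext <;> simp
  | add x y hx hy => rw [map_add, map_add, hx, hy]; ext <;> simp [mul_add]
  | single w r =>
    have : Finsupp.single w r = r • word F w := by simp [word]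
    rw [this, map_smul, consL_word, map_smul, map_smul, topL_word_cons]
    ext <;> simp

theorem topL_diamond {t : ℕ → L} (ht : LinearIndependent F t) (x y : Comp F) :
    topL F t (diamond F x y) = topL F t x * topL F t y := by
  refine map_bilin _ (fun u v => ?_) x y
  match u, v with
  | [], v => rw [diamondWord, topL_word_nil, one_mul]
  | a :: u, [] => rw [diamondWord, topL_word_nil, mul_one]
  | a :: u, b :: v =>
    rw [diamondWord, topL_word_cons, topL_word_cons, map_add, map_sum, topL_consL]
    simp only [map_smul, topL_consL, nestedL_letterShuffle ht, nestedL_shuffleWord ht]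
    ext d
    · simp [Prod.fst_sum]
    · have : levelSum F t d a * nested F t u d * (levelSum F t d b * nested F t v d) =
        levelSum F t d a * levelSum F t d b * (nested F t u d * nested F t v d) := by ring
      simp only [Prod.snd_add, Prod.snd_sum, Pi.add_apply, Finset.sum_apply, Prod.smul_snd,
        Pi.smul_apply, Pi.mul_apply, Prod.snd_mul]
      rw [this, levelSum_mul ht, add_mul, Finset.sum_mul]
      congr 1
      refine Finset.sum_congr rfl fun j _ => ?_
      simp only [Algebra.smul_def]
      ring

/-- Summing top-level contributions over all levels recovers the nested sum. The empty word would be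
counted once per level instead of once in all; its coefficient, recorded by `topL`, corrects this.
-/
theorem nestedL_eq_sum_topL (t : ℕ → L) (x : Comp F) (d : ℕ) :
    nestedL F t x d = algebraMap F L (topL F t x).1 +
      ∑ e ∈ Finset.range d, ((topL F t x).2 e - algebraMap F L (topL F t x).1) := by
  induction x using Finsupp.induction_linear with
  | zero => simp
  | add x y hx hy =>
    simp only [map_add, Pi.add_apply, Prod.fst_add, Prod.snd_add, hx, hy, add_sub_add_comm,
      Finset.sum_add_distrib]
    ring
  | single w r =>
    have : Finsupp.single w r = r • word F w := by simp [word]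
    rw [this, map_smul, map_smul]
    cases w with
    | nil => simp [topL_word_nil, nested, Algebra.smul_def]
    | cons a u => simp [topL_word_cons, nested, Finset.smul_sum]

theorem topL_injective {t : ℕ → L} (h : Function.Injective (nestedL F t)) :
    Function.Injective (topL F t) := by
  rw [injective_iff_map_eq_zero]
  intro x hx
  refine (injective_iff_map_eq_zero _).1 h x (funext fun d => ?_)
  simp [nestedL_eq_sum_topL, hx]

end PowerSums

/-! ### Injectivity for algebraically independent sequences -/

section Injectivity

/-- Power sums of `1 / (τ + β c)` with different exponents are linearly independent over a field
over which `τ` is transcendental, because they have poles of different orders at `τ = 0`. -/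
theorem coeff_eq_zero_of_sum_inv_pow {K L ι : Type*} [Field K] [Field L] [Algebra K L] [Fintype ι]
    {τ : L} (hτ : Transcendental K τ) {β : ι → K} (hβ : Function.Injective β) {c₀ : ι}
    (h₀ : β c₀ = 0) {B : Finset ℕ+} {k : ℕ+ → K}
    (h : ∑ a ∈ B, algebraMap K L (k a) * ∑ c, (τ + algebraMap K L (β c))⁻¹ ^ (a : ℕ) = 0) :
    ∀ a ∈ B, k a = 0 := by
  classical
  by_contra! hne
  obtain ⟨a₁, ha₁, hk₁⟩ := hne
  obtain ⟨N, hN, hmax⟩ := Finset.exists_max_image (B.filter fun a => k a ≠ 0) id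
    ⟨a₁, by simp [ha₁, hk₁]⟩
  rw [Finset.mem_filter] at hN
  have hle : ∀ a ∈ B, k a ≠ 0 → (a : ℕ) ≤ N := fun a ha hk =>
    PNat.coe_le_coe _ _ |>.2 (hmax a (by simp [ha, hk]))
  -- The relation with denominators cleared, `τ` becoming the variable. The truncated difference `N
  -- - a` is harmless: `k a = 0` when `a > N`.
  set Q : K[X] := ∑ a ∈ B, C (k a) * ∑ c, (X + C (β c)) ^ ((N : ℕ) - a) *
    ∏ c' ∈ Finset.univ.erase c, (X + C (β c')) ^ (N : ℕ) with hQ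
  have hx : ∀ c, τ + algebraMap K L (β c) ≠ 0 := by
    intro c hc
    apply hτ
    rw [eq_neg_of_add_eq_zero_left hc, ← map_neg]
    exact isAlgebraic_algebraMap _
  have hQτ : aeval τ Q = (∏ c, (τ + algebraMap K L (β c)) ^ (N : ℕ)) *
      ∑ a ∈ B, algebraMap K L (k a) * ∑ c, (τ + algebraMap K L (β c))⁻¹ ^ (a : ℕ) := by
    simp only [hQ, map_sum, map_mul, map_prod, map_pow, map_add, aeval_X, aeval_C]
    rw [Finset.mul_sum]
    refine Finset.sum_congr rfl fun a ha => ?_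
    by_cases hk : k a = 0
    · simp [hk]
    rw [mul_left_comm]
    congr 1
    rw [Finset.mul_sum]
    refine Finset.sum_congr rfl fun c _ => ?_
    rw [← Finset.mul_prod_erase _ _ (Finset.mem_univ c), mul_right_comm]
    congr 1
    rw [inv_pow, pow_sub₀ _ (hx c) (hle a ha hk)]
  have hQ0 : Q = 0 := by
    by_contra hne
    exact hτ ⟨Q, hne, by rw [hQτ, h, mul_zero]⟩
  -- Only the pole of maximal order `N` at `τ = 0` survives: terms with `c ≠ c₀` contain the factor
  -- `β c₀ ^ N = 0`, and those with `c = c₀`, `a < N` contain a positive power of `0`.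
  have he : Q.eval 0 = k N * ∏ c' ∈ Finset.univ.erase c₀, β c' ^ (N : ℕ) := by
    simp only [hQ, eval_finsetSum, eval_mul, eval_prod, eval_pow, eval_add, eval_X, eval_C,
      zero_add]
    rw [Finset.sum_eq_single_of_mem N hN.1]
    · rw [Finset.sum_eq_single_of_mem c₀ (Finset.mem_univ _)]
      · simp
      · intro c _ hc
        rw [Finset.prod_eq_zero (i := c₀) (by simp [hc.symm]) (by simp [h₀]), mul_zero]
    · intro a ha haN
      by_cases hk : k a = 0
      · simp [hk]
      have hlt : (a : ℕ) < N := lt_of_le_of_ne (hle a ha hk) fun e => haN (PNat.eq e)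
      rw [Finset.sum_eq_zero, mul_zero]
      intro c _
      by_cases hc : c = c₀
      · rw [hc, h₀, zero_pow (by omega), zero_mul]
      · rw [Finset.prod_eq_zero (i := c₀) (by simp [Ne.symm hc]) (by simp [h₀]), mul_zero]
  rw [hQ0, eval_zero] at he
  refine mul_ne_zero hN.2 (Finset.prod_ne_zero_iff.2 fun c hc => pow_ne_zero _ fun e => ?_) he.symm
  exact (Finset.mem_erase.1 hc).1 (hβ (e.trans h₀.symm))

variable {F : Type*} [Field F]

variable (F) in
/-- The linear map removing the first letter of the words that begin with `x_a` and killing all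
other words. -/
def tailL (a : ℕ+) : Comp F →ₗ[F] Comp F :=
  Finsupp.lcomapDomain (List.cons a) (List.cons_injective)

theorem tailL_apply (a : ℕ+) (x : Comp F) (w : List ℕ+) : tailL F a x w = x (a :: w) := rfl

theorem tailL_word_nil (a : ℕ+) : tailL F a (word F []) = 0 := by
  ext w; simp [tailL_apply, word]

theorem tailL_word_cons (a b : ℕ+) (u : List ℕ+) :
    tailL F a (word F (b :: u)) = if b = a then word F u else 0 := by
  ext w
  rw [tailL_apply]
  split_ifs with h
  · subst h
    simp [word, Finsupp.single_apply]
  · simp [word, h]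

variable [Finite F] {L : Type*} [Field L] [Algebra F L]

theorem nestedL_zero (t : ℕ → L) (x : Comp F) : nestedL F t x 0 = algebraMap F L (x []) := by
  induction x using Finsupp.induction_linear with
  | zero => simp
  | add x y hx hy => simp [hx, hy]
  | single w r =>
    rw [nestedL_single]
    cases w <;> simp [nested, Algebra.smul_def]

/-- The increment from `d` to `d + 1` comes from words whose first letter is placed at level `d`.
Allowing every `B ⊇ A` lets index sets be merged and any chosen letter be adjoined. -/
theorem exists_nestedL_succ (t : ℕ → L) (x : Comp F) :
    ∃ A : Finset ℕ+, ∀ B, A ⊆ B → ∀ d, nestedL F t x (d + 1) =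
      nestedL F t x d + ∑ a ∈ B, levelSum F t d a * nestedL F t (tailL F a x) d := by
  induction x using Finsupp.induction_linear with
  | zero => exact ⟨∅, by simp⟩
  | add x y hx hy =>
    obtain ⟨A, hA⟩ := hx
    obtain ⟨A', hA'⟩ := hy
    refine ⟨A ∪ A', fun B hB d => ?_⟩
    simp only [map_add, Pi.add_apply, mul_add, Finset.sum_add_distrib,
      hA B (Finset.union_subset_left hB), hA' B (Finset.union_subset_right hB)]
    ring
  | single w r =>
    have hw : Finsupp.single w r = r • word F w := by simp [word]
    simp only [hw, map_smul, nestedL_word]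
    cases w with
    | nil => exact ⟨∅, by simp [nested, tailL_word_nil]⟩
    | cons b u =>
      refine ⟨{b}, fun B hB d => ?_⟩
      rw [Finset.sum_eq_single_of_mem b (hB (by simp))]
      · simp [tailL_word_cons, nested, Finset.sum_range_succ]
      · intro a _ hab
        simp [tailL_word_cons, hab.symm]

variable (F) in
/-- The field generated by `t_i`, `i < d`. -/
abbrev levelField (t : ℕ → L) (d : ℕ) : IntermediateField F L :=
  IntermediateField.adjoin F (t '' Set.Iio d)

omit [Finite F] in
theorem mem_levelField (t : ℕ → L) {i d : ℕ} (h : i < d) : t i ∈ levelField F t d :=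
  IntermediateField.subset_adjoin F _ ⟨i, h, rfl⟩

omit [Finite F] in
theorem linComb_mem_levelField (t : ℕ → L) {e d : ℕ} (h : e ≤ d) (c : Fin e → F) :
    linComb t e c ∈ levelField F t d :=
  sum_mem fun i _ => IntermediateField.smul_mem _ (mem_levelField t (i.2.trans_le h))

theorem nested_mem_levelField (t : ℕ → L) (w : List ℕ+) {e d : ℕ} (h : e ≤ d) :
    nested F t w e ∈ levelField F t d := by
  induction w generalizing e with
  | nil => exact one_mem _
  | cons a u ih =>
    refine sum_mem fun i hi => mul_mem (sum_mem fun c _ => ?_) ?_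
    · have hi := Finset.mem_range.1 hi
      exact pow_mem (inv_mem (add_mem (mem_levelField t (by omega))
        (linComb_mem_levelField t (by omega) c))) _
    · exact ih ((Finset.mem_range.1 hi).le.trans h)

theorem nestedL_mem_levelField (t : ℕ → L) (x : Comp F) (d : ℕ) :
    nestedL F t x d ∈ levelField F t d := by
  induction x using Finsupp.induction_linear with
  | zero => simp
  | add x y hx hy => rw [map_add]; exact add_mem hx hy
  | single w r =>
    rw [nestedL_single]
    exact IntermediateField.smul_mem _ (nested_mem_levelField t w le_rfl)

/-- The vanishing increment at level `d` is a combination of level sums with coefficients in the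
field generated by the earlier `t_i`. Over that field `t d` is transcendental, so every coefficient
is zero. -/
theorem nestedL_tailL_eq_zero {t : ℕ → L} (ht : AlgebraicIndependent F t) {x : Comp F}
    (hx : nestedL F t x = 0) (a : ℕ+) : nestedL F t (tailL F a x) = 0 := by
  obtain ⟨A, hA⟩ := exists_nestedL_succ t x
  funext d
  have h := hA (insert a A) (Finset.subset_insert _ _) d
  simp only [hx, Pi.zero_apply, zero_add] at h
  have hτ : Transcendental (levelField F t d) (t d) :=
    IntermediateField.transcendental_adjoin_iff.2 (ht.transcendental_adjoin (by simp))
  have key := coeff_eq_zero_of_sum_inv_pow hτ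
    (β := fun c : Fin d → F => ⟨linComb t d c, linComb_mem_levelField t le_rfl c⟩)
    (c₀ := 0) (B := insert a A)
    (k := fun a => ⟨nestedL F t (tailL F a x) d, nestedL_mem_levelField t _ d⟩)
    (fun c c' hc => linComb_injective ht.linearIndependent d (congrArg Subtype.val hc))
    (Subtype.ext (by simp [linComb]))
    (by rw [h]; exact Finset.sum_congr rfl fun a _ => mul_comm _ _)
    a (Finset.mem_insert_self _ _)
  exact congrArg Subtype.val key

/-- The value at `d = 0` is the coefficient of the empty word; stripping first letters reduces every
other coefficient to that one. -/
theorem nestedL_injective {t : ℕ → L} (ht : AlgebraicIndependent F t) :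
    Function.Injective (nestedL F t) := by
  rw [injective_iff_map_eq_zero]
  intro x hx
  ext w
  induction w generalizing x with
  | nil =>
    have := nestedL_zero t x
    rw [hx] at this
    exact (algebraMap F L).injective (by simpa using this.symm)
  | cons a u ih => exact ih (tailL F a x) (nestedL_tailL_eq_zero ht hx a)

variable (F) in
/-- Independent variables over `F`. -/
def genericSeq (i : ℕ) : FractionRing (MvPolynomial ℕ F) :=
  algebraMap (MvPolynomial ℕ F) _ (MvPolynomial.X i)

omit [Finite F] in
theorem algebraicIndependent_genericSeq : AlgebraicIndependent F (genericSeq F) :=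
  (MvPolynomial.algebraicIndependent_X ℕ F).map'
    (f := IsScalarTower.toAlgHom F (MvPolynomial ℕ F) (FractionRing (MvPolynomial ℕ F)))
    (IsFractionRing.injective _ _)

theorem isCommAlgProduct_shuffle : IsCommAlgProduct (shuffle F) (word F []) :=
  have ht := algebraicIndependent_genericSeq (F := F)
  isCommAlgProduct_of_injective (nestedL F (genericSeq F)) (nestedL_injective ht)
    (nestedL_shuffle ht.linearIndependent) (by rw [nestedL_word]; rfl)

theorem isCommAlgProduct_diamond : IsCommAlgProduct (diamond F) (word F []) :=
  have ht := algebraicIndependent_genericSeq (F := F)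
  isCommAlgProduct_of_injective (topL F (genericSeq F)) (topL_injective (nestedL_injective ht))
    (topL_diamond ht.linearIndependent) (topL_word_nil _)

end Injectivity

/-! ### Power sums over monic polynomials -/

section Monic

variable {F : Type*} [Field F]

instance : IsScalarTower F (RatFunc F) (KInf F) := IsScalarTower.of_algebraMap_eq' rfl

variable (F) in
/-- The powers of `θ` in the completion. -/
def thetaPow (i : ℕ) : KInf F :=
  algebraMap (RatFunc F) (KInf F) (algebraMap F[X] (RatFunc F) (X ^ i))

variable (F) in
theorem linearIndependent_thetaPow : LinearIndependent F (thetaPow F) := by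
  have h1 : LinearIndependent F fun i : ℕ => (X ^ i : F[X]) := by
    convert (basisMonomials F).linearIndependent with i
    simp [X_pow_eq_monomial]
  let f : F[X] →ₗ[F] KInf F :=
    (IsScalarTower.toAlgHom F (RatFunc F) (KInf F)).toLinearMap ∘ₗ
      (IsScalarTower.toAlgHom F F[X] (RatFunc F)).toLinearMap
  have hf : Function.Injective f :=
    (algebraMap (RatFunc F) (KInf F)).injective.comp (IsFractionRing.injective F[X] (RatFunc F))
  exact h1.map' f (LinearMap.ker_eq_bot.2 hf)

/-- The monic polynomial with given lower coefficients. -/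
def monicOf (d : ℕ) (c : Fin d → F) : F[X] := X ^ d + ∑ i, C (c i) * X ^ (i : ℕ)

theorem degree_sum_lt (d : ℕ) (c : Fin d → F) : 
    (∑ i, C (c i) * X ^ (i : ℕ)).degree < (d : WithBot ℕ) := by
  rw [← mem_degreeLT]
  exact sum_mem fun i _ => mem_degreeLT.2
    ((degree_C_mul_X_pow_le _ _).trans_lt (by exact_mod_cast i.2))

theorem monic_monicOf (d : ℕ) (c : Fin d → F) : (monicOf d c).Monic :=
  monic_X_pow_add (degree_sum_lt d c)

theorem natDegree_monicOf (d : ℕ) (c : Fin d → F) : (monicOf d c).natDegree = d :=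
  by
  rw [monicOf, add_comm, natDegree_add_eq_right_of_degree_lt, natDegree_X_pow]
  simpa using degree_sum_lt d c

theorem coeff_monicOf (d : ℕ) (c : Fin d → F) (i : Fin d) : (monicOf d c).coeff i = c i := by
  simp [monicOf, coeff_X_pow, i.2.ne, Fin.val_inj]

theorem monicOf_coeff {p : F[X]} (hp : p.Monic) :
    monicOf p.natDegree (fun i => p.coeff i) = p := by
  conv_rhs => rw [hp.as_sum]
  rw [monicOf, Finset.sum_range]

theorem algebraMap_monicOf (d : ℕ) (c : Fin d → F) :
    algebraMap (RatFunc F) (KInf F) (algebraMap F[X] (RatFunc F) (monicOf d c)) =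
      thetaPow F d + linComb (thetaPow F) d c := by
  simp only [monicOf, map_add, map_sum, map_mul, thetaPow, linComb]
  congr 1

theorem term_cons (s : ℕ+) (u : List ℕ+) (a : Chain F (s :: u).length) (b : Chain F u.length)
    (h : ∀ i, b.1 i = a.1 (Fin.succ i)) :
    term F (s :: u) a = (algebraMap (RatFunc F) (KInf F) (algebraMap F[X] (RatFunc F) (a.1 0)))⁻¹ ^
      (s : ℕ) * term F u b := by
  have : ∏ i : Fin (s :: u).length, 1 / (algebraMap F[X] (RatFunc F) (a.1 i)) ^
      (((s :: u).get i : ℕ+) : ℕ) = 1 / (algebraMap F[X] (RatFunc F) (a.1 0)) ^ (s : ℕ) *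
        ∏ i, 1 / (algebraMap F[X] (RatFunc F) (b.1 i)) ^ (u.get i : ℕ) := by
    simp only [h]
    exact Fin.prod_univ_succ (n := u.length) _
  rw [term, term, this, map_mul, one_div, map_inv₀, map_pow, inv_pow]

/-- Prepending a monic polynomial of degree `e` to a chain of degrees `< e`. -/
def Chain.cons {r : ℕ} (p : F[X]) (hp : p.Monic) (b : Chain F r)
    (hb : ∀ i, ((b.1 i).natDegree : ℤ) < p.natDegree) : Chain F (r + 1) :=
  ⟨Fin.cons p b.1, Fin.cases hp b.2.1, fun i j hij => by
    cases j using Fin.cases with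
    | zero => exact absurd hij (Fin.not_lt_zero i)
    | succ j =>
      cases i using Fin.cases with
      | zero => simpa using hb j
      | succ i => simpa using b.2.2 i j (Fin.succ_lt_succ_iff.1 hij)⟩

theorem term_chainCons (s : ℕ+) (u : List ℕ+) (p : F[X]) (hp : p.Monic) (b : Chain F u.length)
    (hb : ∀ i, ((b.1 i).natDegree : ℤ) < p.natDegree) :
    term F (s :: u) (Chain.cons p hp b hb) =
      (algebraMap (RatFunc F) (KInf F) (algebraMap F[X] (RatFunc F) p))⁻¹ ^ (s : ℕ) *
        term F u b := by
  have h0 : (Chain.cons p hp b hb).1 0 = p := rfl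
  have h := term_cons s u (Chain.cons p hp b hb) b fun _ => rfl
  rwa [h0] at h

/-- Removing the first entry of a chain. -/
def Chain.tail {r : ℕ} (a : Chain F (r + 1)) : Chain F r :=
  ⟨fun i => a.1 i.succ, fun _ => a.2.1 _, fun _ _ h => a.2.2 _ _ (Fin.succ_lt_succ_iff.2 h)⟩

variable [Finite F]

/-- Chains are sorted by the degree `e` of their first entry, which is a monic polynomial given by
`e` free coefficients; the rest is a chain of degrees below `e`. -/
theorem powerSumWord_cons (s : ℕ+) (u : List ℕ+) (d : ℕ) :
    powerSumWord F d (s :: u) =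
      ∑ e ∈ Finset.range d, levelSum F (thetaPow F) e s * powerSumWord F e u := by
  simp only [powerSumWord, levelSum, Finset.sum_mul_sum, ← algebraMap_monicOf]
  simp only [← Finset.sum_product', Finset.sum_sigma']
  symm
  refine Finset.sum_bij
    (fun x hx => Chain.cons (monicOf x.1 x.2.1) (monic_monicOf _ _) x.2.2 ?_) ?_ ?_ ?_ ?_
  · rw [natDegree_monicOf]
    simpa using (Finset.mem_sigma.1 hx).2
  · rintro ⟨e, c, b⟩ hx
    simp only [Finset.mem_sigma, Finset.mem_range, Finset.mem_product, Finset.mem_univ, true_and,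
      Set.Finite.mem_toFinset, Set.mem_ofPred_eq] at hx ⊢
    refine Fin.cases ?_ fun i => ?_
    · simpa [Chain.cons, natDegree_monicOf] using hx.1
    · have := hx.2 i
      simp only [Chain.cons, Fin.cons_succ]
      omega
  · rintro ⟨e, c, b⟩ hx ⟨e', c', b'⟩ hx' h
    have h' := congrArg Subtype.val h
    have h0 : monicOf e c = monicOf e' c' := congrFun h' 0
    have he : e = e' := by
      rw [← natDegree_monicOf e c, h0, natDegree_monicOf]
    subst he
    have hc : c = c' := funext fun i => by
      rw [← coeff_monicOf e c, h0, coeff_monicOf]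
    have hb : b = b' := Subtype.ext (funext fun i => congrFun h' i.succ)
    rw [hc, hb]
  · intro a ha
    rw [Set.Finite.mem_toFinset, Set.mem_ofPred_eq] at ha
    refine ⟨⟨(a.1 0).natDegree, fun i => (a.1 0).coeff i, Chain.tail a⟩, ?_, ?_⟩
    · simp only [Finset.mem_sigma, Finset.mem_range, Finset.mem_product, Finset.mem_univ, true_and,
        Set.Finite.mem_toFinset, Set.mem_ofPred_eq]
      exact ⟨by exact_mod_cast ha 0, fun i => by exact_mod_cast a.2.2 0 i.succ (Fin.succ_pos i)⟩
    · refine Subtype.ext (funext (Fin.cases ?_ fun i => rfl))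
      exact monicOf_coeff (a.2.1 0)
  · rintro ⟨e, c, b⟩ hx
    exact (term_chainCons s u _ _ b _).symm

theorem powerSumWord_nil (d : ℤ) : powerSumWord F d [] = 1 := by
  have h : ∀ a : Chain F ([] : List ℕ+).length, term F [] a = 1 := fun a => by
    rw [term, ← map_one (algebraMap (RatFunc F) (KInf F))]
    exact congrArg _ (Finset.prod_empty)
  rw [powerSumWord, Finset.sum_congr rfl fun a _ => h a, Finset.sum_const, Finset.card_eq_one.2,
    one_smul]
  refine ⟨⟨Fin.elim0, fun i => i.elim0, fun i => i.elim0⟩, Finset.ext fun a => ?_⟩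
  simp only [Set.Finite.mem_toFinset, Set.mem_ofPred_eq]
  exact ⟨fun _ => Finset.mem_singleton.2 (Subtype.ext (_root_.funext fun i => Fin.elim0 i)), fun _ i => Fin.elim0 i⟩

theorem powerSumWord_natCast (s : List ℕ+) (d : ℕ) :
    powerSumWord F d s = nested F (thetaPow F) s d := by
  induction s generalizing d with
  | nil => exact powerSumWord_nil d
  | cons a u ih => simp only [powerSumWord_cons, nested, ih]

theorem powerSumWord_toNat (s : List ℕ+) (d : ℤ) :
    powerSumWord F d s = powerSumWord F d.toNat s := by
  rw [powerSumWord, powerSumWord]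
  refine Finset.sum_congr ?_ fun _ _ => rfl
  ext a
  simp only [Set.Finite.mem_toFinset, Set.mem_ofPred_eq]
  exact forall_congr' fun i => by omega

theorem powerSum_eq_nestedL (x : Comp F) (d : ℤ) :
    powerSum F d x = nestedL F (thetaPow F) x d.toNat := by
  induction x using Finsupp.induction_linear with
  | zero => simp
  | add x y hx hy => simp [hx, hy]
  | single w r =>
    rw [nestedL_single, Pi.smul_apply, ← powerSumWord_natCast, ← powerSumWord_toNat]
    simp [powerSum]

theorem powerSum_shuffle (d : ℤ) (x y : Comp F) :
    powerSum F d (shuffle F x y) = powerSum F d x * powerSum F d y := by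
  simp [powerSum_eq_nestedL, nestedL_shuffle (linearIndependent_thetaPow F)]

end Monic

/-! ### Convergence and multiple zeta values -/

section Convergence

variable {F : Type*} [Field F]

open Filter Topology

open Classical in
instance : CompleteSpace (KInf F) :=
  letI := RatFunc.inftyValued F
  inferInstanceAs (CompleteSpace (UniformSpace.Completion (RatFunc F)))

open Classical in
theorem valued_algebraMap (x : RatFunc F) :
    Valued.v (algebraMap (RatFunc F) (KInf F) x) = RatFunc.inftyValuation F x := by
  rw [RatFunc.valuedCompletionAtInfty.def]
  let := RatFunc.inftyValued F
  exact Valued.extensionValuation_apply_coe x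

-- Balls around zero are additive subgroups. Together with completeness, this reduces summability to
-- terms tending to zero.
open MonoidWithZeroHom in
instance : NonarchimedeanRing (KInf F) where
  is_nonarchimedean U hU := by
    obtain ⟨γ, hγ⟩ := Valued.mem_nhds_zero.1 hU
    have hγ0 : ValueGroup₀.embedding γ.1 ≠ 0 := by simp
    let G := (Valued.v (R := KInf F)).ltAddSubgroup (Units.mk0 _ hγ0)
    have hG : (G : Set (KInf F)) = {x | Valued.v.restrict x < γ.1} := by
      ext x
      simp [G, Valuation.restrict_lt_iff_lt_embedding]
    exact ⟨⟨G, G.isOpen_of_mem_nhds (g := 0) (Valued.mem_nhds_zero.2 ⟨γ, hG.ge⟩)⟩, hG.trans_le hγ⟩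

open Classical WithZero in
theorem valued_monic_inv_pow {p : F[X]} (hp : p.Monic) (s : ℕ) :
    Valued.v (algebraMap (RatFunc F) (KInf F) (1 / (algebraMap F[X] (RatFunc F) p) ^ s)) =
      (exp (-(p.natDegree : ℤ))) ^ s := by
  rw [valued_algebraMap, map_div₀, map_one, map_pow, RatFunc.inftyValuation_apply,
    RatFunc.inftyValuation.polynomial _ hp.ne_zero, one_div, exp_neg, inv_pow]

-- Every factor has valuation at most 1, and the `i`-th occurs with exponent at least 1.
open WithZero in
theorem valued_term_le (s : List ℕ+) (a : Chain F s.length) (i : Fin s.length) :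
    Valued.v (term F s a) ≤ exp (-((a.1 i).natDegree : ℤ)) := by
  have h1 : ∀ j, exp (-((a.1 j).natDegree : ℤ)) ≤ 1 := fun j => by
    rw [← exp_zero, exp_le_exp]; omega
  rw [term, map_prod, map_prod, ← Finset.mul_prod_erase _ _ (Finset.mem_univ i)]
  simp only [valued_monic_inv_pow (a.2.1 _)]
  refine (mul_le_of_le_one_right' (Finset.prod_le_one' fun j _ => pow_le_one' (h1 j) _)).trans ?_
  exact pow_le_of_le_one zero_le (h1 i) (s.get i).ne_zero

open MonoidWithZeroHom WithZero in
theorem summable_term [Finite F] (s : List ℕ+) : Summable (term F s) := by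
  refine NonarchimedeanAddGroup.summable_of_tendsto_cofinite_zero ?_
  refine (Valued.hasBasis_nhds_zero _ _).tendsto_right_iff.2 fun γ _ => ?_
  have hγ0 : ValueGroup₀.embedding γ.1 ≠ 0 := by simp
  obtain ⟨n, hn⟩ : ∃ n : ℤ, exp n = ValueGroup₀.embedding γ.1 := ⟨_, exp_log hγ0⟩
  -- A single entry of degree at least `-n + 1` already forces the valuation of the term below `exp
  -- n`.
  refine (finite_chains F s.length (-n + 1)).subset fun a ha i => ?_
  by_contra hi
  refine ha ?_
  simp only [Set.mem_ofPred_eq, Valuation.restrict_lt_iff_lt_embedding, ← hn]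
  refine (valued_term_le s a i).trans_lt (exp_lt_exp.2 ?_)
  omega

variable [Finite F]

theorem tendsto_powerSumWord (s : List ℕ+) :
    Tendsto (fun d : ℕ => powerSumWord F d s) atTop (𝓝 (zetaWord F s)) := by
  refine (summable_term s).hasSum.comp (tendsto_atTop_finset_of_monotone ?_ fun a => ?_)
  · intro d d' h a ha
    simp only [Set.Finite.mem_toFinset, Set.mem_ofPred_eq] at ha ⊢
    exact fun i => (ha i).trans_le (by exact_mod_cast h)
  -- The sum of the degrees bounds each of them and also makes sense for the empty chain.
  · refine ⟨(∑ i, (a.1 i).natDegree) + 1, ?_⟩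
    simp only [Set.Finite.mem_toFinset, Set.mem_ofPred_eq]
    intro i
    have := Finset.single_le_sum (f := fun i => (a.1 i).natDegree) (fun _ _ => Nat.zero_le _)
      (Finset.mem_univ i)
    exact_mod_cast Nat.lt_succ_of_le this

theorem tendsto_powerSum (x : Comp F) :
    Tendsto (fun d : ℕ => powerSum F d x) atTop (𝓝 (zeta F x)) := by
  induction x using Finsupp.induction_linear with
  | zero => simp
  | add x y hx hy => simpa using hx.add hy
  | single w r =>
    have h : ∀ z : KInf F, r • z = algebraMap F (KInf F) r * z := fun z => Algebra.smul_def r z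
    simpa [powerSum, zeta, h] using (tendsto_powerSumWord w).const_mul (algebraMap F (KInf F) r)

theorem zeta_shuffle (x y : Comp F) : zeta F (shuffle F x y) = zeta F x * zeta F y :=
  tendsto_nhds_unique (tendsto_powerSum _) <| by
    simpa only [powerSum_shuffle] using (tendsto_powerSum x).mul (tendsto_powerSum y)

omit [Finite F] in
theorem zeta_word (s : List ℕ+) : zeta F (word F s) = zetaWord F s := by
  simp [zeta, word]

end Convergence

/-! ### The algebra of multiple zeta values -/

section ZetaAlgebra

variable {F : Type*} [Field F] [Finite F]

theorem zeta_word_nil : zeta F (word F []) = 1 :=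
  tendsto_nhds_unique (tendsto_powerSum _) <| by
    simp [powerSum, word, powerSumWord_nil]

/-- The map `ζ_A` as an algebra homomorphism. -/
def zetaHom (h : IsCommAlgProduct (shuffle F) (word F [])) : WithProduct h →ₐ[F] KInf F :=
  AlgHom.ofLinearMap (zeta F : Comp F →ₗ[F] KInf F) zeta_word_nil zeta_shuffle

/-- The scalar extension of `ζ_A` to `F(θ)`. -/
def zetaExt (h : IsCommAlgProduct (shuffle F) (word F [])) :
    RatFunc F ⊗[F] WithProduct h →ₐ[RatFunc F] KInf F :=
  Algebra.TensorProduct.productLeftAlgHom (Algebra.ofId (RatFunc F) (KInf F)) (zetaHom h)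

theorem zetaExt_tmul (h : IsCommAlgProduct (shuffle F) (word F [])) (c : RatFunc F) (x : Comp F) :
    zetaExt h (c ⊗ₜ[F] WithProduct.of h x) = c • zeta F x := by
  rw [Algebra.smul_def]
  exact Algebra.TensorProduct.lift_tmul _ _ (fun _ _ => Commute.all _ _) _ _

omit [Finite F] in
theorem zeta_mem_mzvSpace (x : Comp F) : zeta F x ∈ mzvSpace F := by
  induction x using Finsupp.induction_linear with
  | zero => simp
  | add x y hx hy => rw [map_add]; exact add_mem hx hy
  | single w r =>
    have : Finsupp.single w r = r • word F w := by simp [word]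
    rw [this, map_smul, zeta_word, ← algebraMap_smul (RatFunc F)]
    exact Submodule.smul_mem _ _ (Submodule.subset_span ⟨w, rfl⟩)

/-- This gives closure of the span under multiplication: the range of an algebra homomorphism is a
subalgebra. -/
theorem toSubmodule_range_zetaExt (h : IsCommAlgProduct (shuffle F) (word F [])) :
    Subalgebra.toSubmodule (zetaExt h).range = mzvSpace F := by
  refine le_antisymm ?_ (Submodule.span_le.2 ?_)
  · rintro _ ⟨z, rfl⟩
    induction z using TensorProduct.induction_on with
    | zero => simp
    | add x y hx hy => simpa using add_mem hx hy
    | tmul c x =>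
      have := zetaExt_tmul h c (x : Comp F)
      exact this ▸ Submodule.smul_mem _ c (zeta_mem_mzvSpace _)
  · rintro _ ⟨s, rfl⟩
    exact ⟨1 ⊗ₜ[F] WithProduct.of h (word F s), by
      rw [← zeta_word, ← one_smul (RatFunc F) (zeta F _)]; exact zetaExt_tmul h 1 _⟩

end ZetaAlgebra

end

end ThakurMZV


theorem theoremA (F : Type*) [Field F] [Finite F] :
    IsCommAlgProduct (diamond F) (word F []) ∧
    ∃ h : IsCommAlgProduct (shuffle F) (word F []),
      (∀ (d : ℤ) (x y : Comp F),
        powerSum F d (shuffle F x y) = powerSum F d x * powerSum F d y) ∧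
      (∀ s : List ℕ+, Summable (term F s)) ∧
      (∀ x y : Comp F, zeta F (shuffle F x y) = zeta F x * zeta F y) ∧
      ∃ Zalg : Subalgebra (RatFunc F) (KInf F),
        Subalgebra.toSubmodule Zalg = mzvSpace F ∧
        ∃ Z : RatFunc F ⊗[F] WithProduct h →ₐ[RatFunc F] Zalg,
          ∀ s : List ℕ+,
            (Z (1 ⊗ₜ[F] WithProduct.of h (word F s)) : KInf F) = zetaWord F s := by
  refine ⟨isCommAlgProduct_diamond, isCommAlgProduct_shuffle, powerSum_shuffle, summable_term,
    zeta_shuffle, (zetaExt isCommAlgProduct_shuffle).range, toSubmodule_range_zetaExt _,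
    (zetaExt isCommAlgProduct_shuffle).rangeRestrict, fun s => ?_⟩
  rw [← zeta_word, ← one_smul (RatFunc F) (zeta F _)]
  exact zetaExt_tmul _ 1 _
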